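/- Let $N\ge 2$ be an integer. On $[0,1]$ let $T_N(x)=Nx \bmod 1\in[0,1)$, and on $[0,1]^2$ let $T_N(x_1,x_2)=(Nx_1 \bmod 1,\,Nx_2 \bmod 1)\in[0,1)^2$; a $\times N$-invariant measure on $[0,1]$ or on $[0,1]^2$ is a Borel probability measure that is invariant under $T_N$. For a Borel probability measure $\nu$ on $\mathbb{R}$ let $$\dim\nu=\liminf_{n\to\infty}\frac1n\sum_{k\in\mathbb{Z}}-\nu(I_{n,k})\log_2\nu(I_{n,k}),\qquad I_{n,k}=[k2^{-n},(k+1)2^{-n}),$$ be its lower entropy dimension (with $0\log_2 0=0$). For $v\in\mathbb{R}^2$ let $P_v(x)=\langle x,v\rangle$, and let $P_v\mu$ be the push-forward of $\mu$ under $P_v$. Let $\lambda$ be Lebesgue measure on $[0,1]$. Let $\mu$ be a $\times N$-invariant measure on $[0,1]^2$. Then the following are equivalent: 1. $\mu$ is a (finite) convex combination of measures of the form $\mu_1\times\lambda$ and $\lambda\times\mu_2$, where $\mu_1,\mu_2$ are $\times N$-invariant measures on $[0,1]$; 2. $\dim P_v\mu=1$ for every $v=(v_1,v_2)\in\mathbb{R}^2$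 with $v_1v_2\ne0$. -/

import Mathlib

open MeasureTheory Filter Set
open scoped NNReal ENNReal

noncomputable section

namespace TimesN

/-- The map `x ↦ N x mod 1` of the circle, with representatives in `[0, 1)`. -/
def mulModOne (N : ℕ) (x : ℝ) : ℝ := Int.fract (N * x)

/-- The map `T_N (x, y) = (N x mod 1, N y mod 1)` of the two-dimensional torus. -/
def mulModOneTwo (N : ℕ) (p : ℝ × ℝ) : ℝ × ℝ := (mulModOne N p.1, mulModOne N p.2)

/-- A `× N`-invariant Borel probability measure on `[0, 1]`. -/
structure IsInvariantOnInterval (N : ℕ) (μ : Measure ℝ) : Prop where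
  isProbability : IsProbabilityMeasure μ
  carried : μ (Icc 0 1)ᶜ = 0
  invariant : μ.map (mulModOne N) = μ

/-- A `× N`-invariant Borel probability measure on `[0, 1]²`. -/
structure IsInvariantOnSquare (N : ℕ) (μ : Measure (ℝ × ℝ)) : Prop where
  isProbability : IsProbabilityMeasure μ
  carried : μ (Icc 0 1 ×ˢ Icc 0 1)ᶜ = 0
  invariant : μ.map (mulModOneTwo N) = μ

/-- Lebesgue measure on `[0, 1]`. -/
def lebesgueUnit : Measure ℝ := volume.restrict (Icc 0 1)

/-- The projection `P_v x = ⟨x, v⟩`. -/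
def proj (v : ℝ × ℝ) (x : ℝ × ℝ) : ℝ := x.1 * v.1 + x.2 * v.2

/-- The `k`-th dyadic interval of length `2⁻ⁿ`. -/
def dyadicInterval (n : ℕ) (k : ℤ) : Set ℝ := Ico ((k : ℝ) / 2 ^ n) (((k : ℝ) + 1) / 2 ^ n)

/-- The `n`-scale Shannon entropy (logarithms to base `2`) of a probability measure on the line,
with respect to the partition into dyadic intervals of length `2⁻ⁿ`. All the summands are
nonnegative, so the sum is taken in `[0, ∞]`. -/
def scaleEntropy (n : ℕ) (μ : Measure ℝ) : ℝ≥0∞ :=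
  ∑' k : ℤ, ENNReal.ofReal
    (-(μ.real (dyadicInterval n k) * Real.logb 2 (μ.real (dyadicInterval n k))))

/-- The (lower) entropy dimension of a probability measure on the line. -/
def entropyDim (μ : Measure ℝ) : ℝ≥0∞ :=
  liminf (fun n : ℕ => scaleEntropy n μ / (n : ℝ≥0∞)) atTop

/-- The measures `μ₁ × λ` and `λ × μ₂`, with `λ` Lebesgue measure on `[0, 1]` and `μ₁`, `μ₂`
`× N`-invariant probability measures on `[0, 1]`. -/
def productsWithLebesgue (N : ℕ) : Set (Measure (ℝ × ℝ)) :=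
  {ν | ∃ μ₁ : Measure ℝ, IsInvariantOnInterval N μ₁ ∧ ν = μ₁.prod lebesgueUnit} ∪
  {ν | ∃ μ₂ : Measure ℝ, IsInvariantOnInterval N μ₂ ∧ ν = lebesgueUnit.prod μ₂}

end TimesN

end

/-! From dimension to structure, only the directions $v=(p,q)$ with nonzero integers $p,q$ matter.
For these, $P_v\mu$ mod 1 is again $\times N$-invariant, hence invariant under $B=N^m$ for every
$m$. By invariance all base-$B$ digits have the same law, so the entropy at scale $2^{-n}$ is at
most $n/\log_2 B$ times the entropy of one digit, up to $O(1)$ (`scaleEntropy_le_digitEntropy`).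
Dimension one therefore forces the first digit to be uniform. The average of $e^{2\pi
i\,\mathrm{digit}/B}$ is then a vanishing sum of roots of unity, and $m\to\infty$ gives
$\hat\mu(p,q)=0$ (`integral_exp_eq_zero_of_entropyDim_eq_one`).

Once all mixed coefficients vanish, comparing Fourier coefficients gives
$\mu+\lambda\times\lambda=\mu_1\times\lambda+\lambda\times\mu_2$ with $\mu_1,\mu_2$ the marginals.
Positivity of $\mu$ then yields $a\in[0,1]$ with $a\lambda\le\mu_1$ and $(1-a)\lambda\le\mu_2$
(`exists_smul_le_of_prod_le`). Removing these Lebesgue parts exhibits $\mu$ as a convex combination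
with weights $1-a$ and $a$.

Conversely, if $v_1v_2\ne0$, each product projects to a measure of bounded density. This property
survives convex combinations and gives scale entropy $n+O(1)$. -/

namespace TimesN

/-! ### Fourier uniqueness on the torus and on the half-open square -/

/-- The character `(x, y) ↦ exp (2πi (p x + q y))`. -/
noncomputable def planeChar (p q : ℤ) (x : ℝ × ℝ) : ℂ :=
  Complex.exp (2 * Real.pi * Complex.I * (p * x.1 + q * x.2))

@[fun_prop]
lemma continuous_planeChar (p q : ℤ) : Continuous (planeChar p q) := by
  unfold planeChar; fun_prop

/-- The projection of the plane onto the two-dimensional torus. -/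
def toTorus (x : ℝ × ℝ) : UnitAddTorus (Fin 2) := ![(x.1 : UnitAddCircle), (x.2 : UnitAddCircle)]

lemma continuous_toTorus : Continuous toTorus := by
  unfold toTorus
  refine continuous_pi fun i ↦ ?_
  fin_cases i
  · exact (AddCircle.continuous_mk' 1).comp continuous_fst
  · exact (AddCircle.continuous_mk' 1).comp continuous_snd

lemma mFourier_toTorus (n : Fin 2 → ℤ) (x : ℝ × ℝ) :
    UnitAddTorus.mFourier n (toTorus x) = planeChar (n 0) (n 1) x := by
  simp only [UnitAddTorus.mFourier, toTorus, ContinuousMap.coe_mk, Fin.prod_univ_two, planeChar]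
  simp only [Matrix.cons_val_zero, Matrix.cons_val_one, fourier_coe_apply, ← Complex.exp_add]
  congr 1
  push_cast
  ring

/-- A finite measure on the torus is determined by its Fourier coefficients. -/
lemma torus_ext_of_mFourier {d : Type*} [Fintype d] {P Q : Measure (UnitAddTorus d)}
    [IsFiniteMeasure P] [IsFiniteMeasure Q]
    (h : ∀ n, ∫ x, UnitAddTorus.mFourier n x ∂P = ∫ x, UnitAddTorus.mFourier n x ∂Q) : P = Q := by
  have hint : ∀ (R : Measure (UnitAddTorus d)) [IsFiniteMeasure R] (g : C(UnitAddTorus d, ℂ)),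
      Integrable g R := fun R _ g ↦
    (BoundedContinuousFunction.mkOfCompact g).integrable R
  -- The functions with equal integrals form a closed subspace; it contains the characters, whose
  -- span is dense.
  let A : Submodule ℂ C(UnitAddTorus d, ℂ) :=
    { carrier := {g | ∫ x, g x ∂P = ∫ x, g x ∂Q}
      zero_mem' := by simp
      add_mem' := by
        intro a b ha hb
        simp only [mem_ofPred_eq, ContinuousMap.add_apply] at *
        rw [integral_add (hint P a) (hint P b), integral_add (hint Q a) (hint Q b), ha, hb]
      smul_mem' := by
        intro c a ha
        simp only [mem_ofPred_eq, ContinuousMap.smul_apply] at *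
        rw [integral_smul, integral_smul, ha] }
  have hcont : ∀ (R : Measure (UnitAddTorus d)) [IsFiniteMeasure R],
      Continuous (fun g : C(UnitAddTorus d, ℂ) ↦ ∫ x, g x ∂(R)) := by
    intro R _
    refine continuous_iff_continuousAt.2 fun g₀ ↦ ?_
    refine tendsto_integral_filter_of_dominated_convergence (fun _ ↦ ‖g₀‖ + 1)
      (Eventually.of_forall fun g ↦ (hint R g).aestronglyMeasurable) ?_
      (integrable_const _) (Eventually.of_forall fun x ↦ ?_)
    · filter_upwards [(continuous_norm.tendsto g₀).eventually (gt_mem_nhds (lt_add_one ‖g₀‖))]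
        with g hg
      exact Eventually.of_forall fun x ↦ (g.norm_coe_le_norm x).trans hg.le
    · exact (continuous_eval_const x).tendsto g₀
  have hA : IsClosed (A : Set C(UnitAddTorus d, ℂ)) := isClosed_eq (hcont P) (hcont Q)
  have htop : A = ⊤ := by
    refine top_unique ?_
    rw [← UnitAddTorus.span_mFourier_closure_eq_top]
    refine Submodule.topologicalClosure_minimal _ (Submodule.span_le.2 ?_) hA
    rintro _ ⟨n, rfl⟩
    exact h n
  refine ext_of_forall_integral_eq_of_IsFiniteMeasure fun f ↦ ?_
  let g : C(UnitAddTorus d, ℂ) := ⟨fun x ↦ (f x : ℂ), by fun_prop⟩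
  have hg : g ∈ A := htop ▸ Submodule.mem_top
  have hg' : ∫ x, (f x : ℂ) ∂P = ∫ x, (f x : ℂ) ∂Q := hg
  simpa only [integral_complex_ofReal, Complex.ofReal_inj] using hg'

/-- A finite measure on `[0, 1)²` is determined by its Fourier coefficients. -/
lemma square_ext_of_planeChar {P Q : Measure (ℝ × ℝ)} [IsFiniteMeasure P] [IsFiniteMeasure Q]
    (hP : P (Ico 0 1 ×ˢ Ico 0 1)ᶜ = 0) (hQ : Q (Ico 0 1 ×ˢ Ico 0 1)ᶜ = 0)
    (h : ∀ p q, ∫ x, planeChar p q x ∂P = ∫ x, planeChar p q x ∂Q) : P = Q := by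
  have hm : Measurable toTorus := continuous_toTorus.measurable
  have key : P.map toTorus = Q.map toTorus := by
    refine torus_ext_of_mFourier fun n ↦ ?_
    rw [integral_map hm.aemeasurable (UnitAddTorus.mFourier n).continuous.aestronglyMeasurable,
      integral_map hm.aemeasurable (UnitAddTorus.mFourier n).continuous.aestronglyMeasurable]
    simpa only [mFourier_toTorus] using h (n 0) (n 1)
  -- A measurable section of the quotient map, inverse to it on $[0,1)$, carries the equality back
  -- to the square.
  let s : UnitAddCircle → ℝ := fun t ↦ (AddCircle.measurableEquivIco 1 0 t : ℝ)
  have hs : Measurable s := measurable_subtype_coe.comp (AddCircle.measurableEquivIco 1 0).measurable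
  have hs' : ∀ t ∈ Ico (0 : ℝ) 1, s (t : UnitAddCircle) = t := by
    intro t ht
    have ht' : t ∈ Ico (0 : ℝ) (0 + 1) := by simpa using ht
    exact congrArg Subtype.val (AddCircle.equivIco_coe_eq (p := (1 : ℝ)) (a := 0) ht')
  let r : UnitAddTorus (Fin 2) → ℝ × ℝ := fun t ↦ (s (t 0), s (t 1))
  have hr : Measurable r := (hs.comp (measurable_pi_apply 0)).prodMk (hs.comp (measurable_pi_apply 1))
  have back : ∀ R : Measure (ℝ × ℝ), R (Ico 0 1 ×ˢ Ico 0 1)ᶜ = 0 → (R.map toTorus).map r = R := by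
    intro R hR
    rw [Measure.map_map hr hm]
    conv_rhs => rw [← Measure.map_id (μ := R)]
    refine Measure.map_congr ?_
    filter_upwards [mem_ae_iff.2 hR] with x hx
    exact Prod.ext (hs' _ hx.1) (hs' _ hx.2)
  rw [← back P hP, ← back Q hQ, key]

/-! ### Invariance of Lebesgue measure and of marginals -/

@[fun_prop]
lemma measurable_mulModOne (N : ℕ) : Measurable (mulModOne N) := by
  unfold mulModOne; fun_prop

@[fun_prop]
lemma measurable_mulModOneTwo (N : ℕ) : Measurable (mulModOneTwo N) := by
  unfold mulModOneTwo; fun_prop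

lemma mulModOne_mem (N : ℕ) (x : ℝ) : mulModOne N x ∈ Ico (0 : ℝ) 1 :=
  ⟨Int.fract_nonneg _, Int.fract_lt_one _⟩

lemma lebesgueUnit_eq_Ico : lebesgueUnit = volume.restrict (Ico (0 : ℝ) 1) :=
  Measure.restrict_congr_set Ico_ae_eq_Icc.symm

lemma lebesgueUnit_eq_Ioc : lebesgueUnit = volume.restrict (Ioc (0 : ℝ) 1) :=
  Measure.restrict_congr_set Ioc_ae_eq_Icc.symm

instance : IsProbabilityMeasure lebesgueUnit := ⟨by simp [lebesgueUnit]⟩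

lemma lebesgueUnit_compl_Ico : lebesgueUnit (Ico 0 1)ᶜ = 0 := by
  rw [lebesgueUnit_eq_Ico, Measure.restrict_apply measurableSet_Ico.compl]
  simp

/-- The section of the circle onto $[0,1)$ intertwines `N • t` with `mulModOne N`, so invariance of
Haar measure transfers. -/
lemma map_mulModOne_lebesgueUnit {N : ℕ} (hN : 1 < N) :
    lebesgueUnit.map (mulModOne N) = lebesgueUnit := by
  let s : UnitAddCircle → ℝ := fun t ↦ (AddCircle.measurableEquivIco 1 0 t : ℝ)
  have hs : Measurable s := measurable_subtype_coe.comp (AddCircle.measurableEquivIco 1 0).measurable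
  have hs' : ∀ t : ℝ, s (t : UnitAddCircle) = Int.fract t := by
    intro t
    have h : (t : UnitAddCircle) = (Int.fract t : ℝ) := by
      rw [← sub_eq_zero, ← AddCircle.coe_sub, Int.self_sub_fract]
      simp
    rw [h]
    have ht' : Int.fract t ∈ Ico (0 : ℝ) (0 + 1) :=
      ⟨Int.fract_nonneg t, (Int.fract_lt_one t).trans_eq (zero_add 1).symm⟩
    exact congrArg Subtype.val (AddCircle.equivIco_coe_eq (p := (1 : ℝ)) (a := 0) ht')
  have hmk : MeasurePreserving (fun x : ℝ ↦ (x : UnitAddCircle)) lebesgueUnit volume := by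
    have := UnitAddCircle.measurePreserving_mk 0
    rwa [zero_add, ← lebesgueUnit_eq_Ioc] at this
  have hvol : (volume : Measure UnitAddCircle).map s = lebesgueUnit := by
    rw [← hmk.map_eq, Measure.map_map hs hmk.measurable]
    conv_rhs => rw [← Measure.map_id (μ := lebesgueUnit)]
    refine Measure.map_congr ?_
    filter_upwards [mem_ae_iff.2 lebesgueUnit_compl_Ico] with x hx
    simpa [hs'] using Int.fract_eq_self.2 hx
  have hT : MeasurePreserving (fun t : UnitAddCircle ↦ N • t) volume volume :=
    (AddCircle.ergodic_nsmul hN).toMeasurePreserving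
  have hcomm : mulModOne N ∘ s = s ∘ fun t : UnitAddCircle ↦ N • t := by
    funext t
    induction t using QuotientAddGroup.induction_on with
    | H x =>
      have h1 : N • (x : UnitAddCircle) = ((N * x : ℝ) : UnitAddCircle) := by
        rw [← AddCircle.coe_nsmul, nsmul_eq_mul]
      change mulModOne N (s (x : UnitAddCircle)) = s (N • (x : UnitAddCircle))
      rw [h1, hs', hs', mulModOne, Int.fract_eq_fract]
      exact ⟨-(N * ⌊x⌋), by rw [Int.fract]; push_cast; ring⟩
  rw [← hvol, Measure.map_map (measurable_mulModOne N) hs, hcomm, ← Measure.map_map hs hT.measurable,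
    hT.map_eq]

lemma isInvariantOnInterval_lebesgueUnit {N : ℕ} (hN : 1 < N) :
    IsInvariantOnInterval N lebesgueUnit where
  isProbability := inferInstance
  carried := measure_mono_null (compl_subset_compl.2 Ico_subset_Icc_self) lebesgueUnit_compl_Ico
  invariant := map_mulModOne_lebesgueUnit hN

/-- The Fourier coefficient of a measure on the line. -/
noncomputable def lineCoeff (p : ℤ) (μ : Measure ℝ) : ℂ :=
  ∫ x, Complex.exp (2 * Real.pi * Complex.I * (p * x)) ∂μ

lemma integral_planeChar_prod (p q : ℤ) (α β : Measure ℝ) [SFinite α] [SFinite β] :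
    ∫ x, planeChar p q x ∂(α.prod β) = lineCoeff p α * lineCoeff q β := by
  rw [lineCoeff, lineCoeff, ← integral_prod_mul]
  refine integral_congr_ae (Eventually.of_forall fun x ↦ ?_)
  simp only [planeChar, ← Complex.exp_add]
  congr 1; ring

lemma lineCoeff_zero (μ : Measure ℝ) [IsProbabilityMeasure μ] : lineCoeff 0 μ = 1 := by
  simp [lineCoeff]

lemma lineCoeff_lebesgueUnit {p : ℤ} (hp : p ≠ 0) : lineCoeff p lebesgueUnit = 0 := by
  rw [lineCoeff, lebesgueUnit_eq_Ioc, ← intervalIntegral.integral_of_le zero_le_one]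
  have hc : (2 * Real.pi * Complex.I * p : ℂ) ≠ 0 :=
    mul_ne_zero Complex.two_pi_I_ne_zero (Int.cast_ne_zero.2 hp)
  simp only [← mul_assoc]
  rw [integral_exp_mul_complex hc]
  have : (2 * Real.pi * Complex.I * p : ℂ) = p * (2 * Real.pi * Complex.I) := by ring
  simp [this, Complex.exp_int_mul_two_pi_mul_I]

lemma lineCoeff_map_fst (p : ℤ) (μ : Measure (ℝ × ℝ)) :
    lineCoeff p (μ.map Prod.fst) = ∫ x, planeChar p 0 x ∂μ := by
  rw [lineCoeff, integral_map measurable_fst.aemeasurable (by fun_prop)]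
  simp [planeChar]

lemma lineCoeff_map_snd (p : ℤ) (μ : Measure (ℝ × ℝ)) :
    lineCoeff p (μ.map Prod.snd) = ∫ x, planeChar 0 p x ∂μ := by
  rw [lineCoeff, integral_map measurable_snd.aemeasurable (by fun_prop)]
  simp [planeChar]

/-- The map takes values in the half-open square, so an invariant measure lives there. This is
needed because Fourier coefficients cannot tell the coordinates 0 and 1 apart. -/
lemma IsInvariantOnSquare.compl_Ico {N : ℕ} {μ : Measure (ℝ × ℝ)} (hμ : IsInvariantOnSquare N μ) :
    μ (Ico 0 1 ×ˢ Ico 0 1)ᶜ = 0 := by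
  rw [← hμ.invariant, Measure.map_apply (by fun_prop)
    (measurableSet_Ico.prod measurableSet_Ico).compl]
  convert measure_empty (μ := μ)
  refine eq_empty_of_forall_notMem fun x hx ↦ hx ?_
  exact ⟨mulModOne_mem N x.1, mulModOne_mem N x.2⟩

lemma IsInvariantOnSquare.map_fst {N : ℕ} {μ : Measure (ℝ × ℝ)} (hμ : IsInvariantOnSquare N μ) :
    IsInvariantOnInterval N (μ.map Prod.fst) where
  isProbability := by
    have := hμ.isProbability
    exact Measure.isProbabilityMeasure_map measurable_fst.aemeasurable
  carried := by
    rw [Measure.map_apply measurable_fst measurableSet_Icc.compl]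
    refine measure_mono_null ?_ hμ.carried
    exact fun x hx h ↦ hx h.1
  invariant := by
    conv_rhs => rw [← hμ.invariant]
    rw [Measure.map_map (by fun_prop) (by fun_prop), Measure.map_map (by fun_prop) (by fun_prop)]
    rfl

lemma IsInvariantOnSquare.map_snd {N : ℕ} {μ : Measure (ℝ × ℝ)} (hμ : IsInvariantOnSquare N μ) :
    IsInvariantOnInterval N (μ.map Prod.snd) where
  isProbability := by
    have := hμ.isProbability
    exact Measure.isProbabilityMeasure_map measurable_snd.aemeasurable
  carried := by
    rw [Measure.map_apply measurable_snd measurableSet_Icc.compl]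
    refine measure_mono_null ?_ hμ.carried
    exact fun x hx h ↦ hx h.2
  invariant := by
    conv_rhs => rw [← hμ.invariant]
    rw [Measure.map_map (by fun_prop) (by fun_prop), Measure.map_map (by fun_prop) (by fun_prop)]
    rfl

/-- If all mixed Fourier coefficients vanish, then the measure is determined by its marginals. -/
lemma IsInvariantOnSquare.add_prod_eq {N : ℕ} {μ : Measure (ℝ × ℝ)} (hμ : IsInvariantOnSquare N μ)
    (h : ∀ p q : ℤ, p ≠ 0 → q ≠ 0 → ∫ x, planeChar p q x ∂μ = 0) :
    μ + lebesgueUnit.prod lebesgueUnit =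
      (μ.map Prod.fst).prod lebesgueUnit + lebesgueUnit.prod (μ.map Prod.snd) := by
  have := hμ.isProbability
  have := hμ.map_fst.isProbability
  have := hμ.map_snd.isProbability
  have hI : ∀ α : Measure (ℝ × ℝ), α (Prod.fst ⁻¹' (Ico 0 1)ᶜ) = 0 → α (Prod.snd ⁻¹' (Ico 0 1)ᶜ) = 0 →
      α (Ico 0 1 ×ˢ Ico 0 1)ᶜ = 0 := fun α h1 h2 ↦
    measure_mono_null (fun x hx ↦ by
      by_contra hc
      simp only [mem_union, mem_preimage, mem_compl_iff, not_or, not_not] at hc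
      exact hx ⟨hc.1, hc.2⟩) (measure_union_null h1 h2)
  have hfst : (μ.map Prod.fst) (Ico 0 1)ᶜ = 0 := by
    rw [Measure.map_apply measurable_fst measurableSet_Ico.compl]
    refine measure_mono_null ?_ hμ.compl_Ico
    exact fun x hx h ↦ hx h.1
  have hsnd : (μ.map Prod.snd) (Ico 0 1)ᶜ = 0 := by
    rw [Measure.map_apply measurable_snd measurableSet_Ico.compl]
    refine measure_mono_null ?_ hμ.compl_Ico
    exact fun x hx h ↦ hx h.2
  have hp : ∀ α β : Measure ℝ, SFinite α → SFinite β → α (Ico 0 1)ᶜ = 0 → β (Ico 0 1)ᶜ = 0 →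
      (α.prod β) (Ico 0 1 ×ˢ Ico 0 1)ᶜ = 0 := by
    intro α β _ _ h1 h2
    refine hI _ ?_ ?_
    · rw [← prod_univ, Measure.prod_prod, h1, zero_mul]
    · rw [← univ_prod, Measure.prod_prod, h2, mul_zero]
  have hint : ∀ (p q : ℤ) (α : Measure (ℝ × ℝ)) [IsFiniteMeasure α],
      Integrable (planeChar p q) α := by
    intro p q α _
    refine Integrable.of_bound (continuous_planeChar p q).aestronglyMeasurable 1
      (Eventually.of_forall fun x ↦ ?_)
    have : (2 * Real.pi * Complex.I * (p * x.1 + q * x.2) : ℂ) =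
        ((2 * Real.pi * (p * x.1 + q * x.2) : ℝ) : ℂ) * Complex.I := by push_cast; ring
    rw [planeChar, this, Complex.norm_exp_ofReal_mul_I]
  refine square_ext_of_planeChar ?_ ?_ fun p q ↦ ?_
  · simp [hμ.compl_Ico, hp _ _ inferInstance inferInstance lebesgueUnit_compl_Ico
      lebesgueUnit_compl_Ico]
  · simp [hp _ _ inferInstance inferInstance hfst lebesgueUnit_compl_Ico,
      hp _ _ inferInstance inferInstance lebesgueUnit_compl_Ico hsnd]
  · rw [integral_add_measure (hint _ _ _) (hint _ _ _),
      integral_add_measure (hint _ _ _) (hint _ _ _), integral_planeChar_prod,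
      integral_planeChar_prod, integral_planeChar_prod]
    rcases eq_or_ne q 0 with rfl | hq
    · rw [lineCoeff_map_fst, lineCoeff_zero, lineCoeff_zero]
      ring
    · rcases eq_or_ne p 0 with rfl | hp
      · rw [lineCoeff_map_snd, lineCoeff_zero, lineCoeff_zero, lineCoeff_lebesgueUnit hq]
        ring
      · rw [h p q hp hq, lineCoeff_lebesgueUnit hq, lineCoeff_lebesgueUnit hp]
        ring

/-! ### Splitting off the Lebesgue parts of the marginals -/

/-- If `λ × λ ≤ μ₁ × λ + λ × μ₂`, then Lebesgue measure splits between `μ₁` and `μ₂`. -/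
lemma exists_smul_le_of_prod_le {α β : Type*} [MeasurableSpace α] [MeasurableSpace β]
    {κ μ₁ : Measure α} {l μ₂ : Measure β} [IsProbabilityMeasure κ] [IsProbabilityMeasure l]
    [IsProbabilityMeasure μ₁] [SFinite μ₂]
    (h : κ.prod l ≤ μ₁.prod l + κ.prod μ₂) :
    ∃ a : ℝ≥0, a ≤ 1 ∧ a • κ ≤ μ₁ ∧ (1 - a) • l ≤ μ₂ := by
  -- The largest constant with `a • κ ≤ μ₁`.
  let a : ℝ≥0∞ := ⨅ (A : Set α) (_ : MeasurableSet A) (_ : κ A ≠ 0), μ₁ A / κ A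
  have ha : a ≤ 1 := by
    refine (iInf₂_le univ MeasurableSet.univ).trans ((iInf_le _ (by simp)).trans (by simp))
  have hatop : a ≠ ⊤ := ne_top_of_le_ne_top ENNReal.one_ne_top ha
  have h1 : a • κ ≤ μ₁ := by
    refine Measure.le_iff.2 fun A hA ↦ ?_
    rw [Measure.smul_apply, smul_eq_mul]
    by_cases h0 : κ A = 0
    · simp [h0]
    · rw [← ENNReal.le_div_iff_mul_le (Or.inl h0) (Or.inl (measure_ne_top κ A))]
      exact (iInf₂_le A hA).trans (iInf_le _ h0)
  have h2 : (1 - a) • l ≤ μ₂ := by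
    refine Measure.le_iff.2 fun B hB ↦ ?_
    rw [Measure.smul_apply, smul_eq_mul]
    by_cases h0 : l B = 0
    · simp [h0]
    have htop := measure_ne_top l B
    -- Testing the hypothesis on rectangles $A\times B$ and dividing by $\kappa(A)$ bounds every
    -- ratio $\mu_1(A)/\kappa(A)$ below by the same number.
    have key : (l B - μ₂ B) / l B ≤ a := by
      refine le_iInf₂ fun A hA ↦ le_iInf fun hA0 ↦ ?_
      have hAB := h (A ×ˢ B)
      rw [Measure.add_apply, Measure.prod_prod, Measure.prod_prod, Measure.prod_prod] at hAB
      have hAtop := measure_ne_top κ A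
      rw [ENNReal.div_le_iff h0 htop, tsub_le_iff_right]
      rw [← ENNReal.mul_le_mul_iff_right hA0 hAtop, mul_add, ← mul_assoc,
        ENNReal.mul_div_cancel hA0 hAtop]
      exact hAB
    rw [ENNReal.div_le_iff h0 htop, tsub_le_iff_right] at key
    rw [ENNReal.sub_mul (fun _ _ ↦ htop), one_mul, tsub_le_iff_left]
    exact key
  refine ⟨a.toNNReal, ?_, ?_, ?_⟩
  · exact_mod_cast (ENNReal.coe_toNNReal hatop).trans_le ha
  · have : a.toNNReal • κ = a • κ := by
      rw [← ENNReal.coe_toNNReal hatop]; rfl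
    rwa [this]
  · have : (1 - a.toNNReal) • l = (1 - a) • l := by
      conv_rhs => rw [← ENNReal.coe_toNNReal hatop, ← ENNReal.coe_one, ← ENNReal.coe_sub]
      rfl
    rwa [this]

lemma exists_eq_smul_isInvariantOnInterval {N : ℕ} (hN : 1 < N) {σ : Measure ℝ} {c : ℝ≥0}
    (hmass : σ univ = c) (hcar : σ (Icc 0 1)ᶜ = 0) (hinv : σ.map (mulModOne N) = σ) :
    ∃ ν, IsInvariantOnInterval N ν ∧ σ = c • ν := by
  rcases eq_or_ne c 0 with rfl | hc
  -- Here `σ = 0`, and any invariant probability measure would do.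
  · refine ⟨lebesgueUnit, isInvariantOnInterval_lebesgueUnit hN, ?_⟩
    rw [zero_smul, ← Measure.measure_univ_eq_zero, hmass, ENNReal.coe_zero]
  · refine ⟨c⁻¹ • σ, ⟨⟨?_⟩, ?_, ?_⟩, (smul_inv_smul₀ hc σ).symm⟩
    · rw [Measure.smul_apply, hmass]
      change ((c⁻¹ : ℝ≥0) : ℝ≥0∞) * c = 1
      rw [← ENNReal.coe_mul, inv_mul_cancel₀ hc, ENNReal.coe_one]
    · simp [hcar]
    · rw [Measure.map_smul, hinv]

lemma add_measure_right_cancel {α : Type*} [MeasurableSpace α] {P Q R : Measure α}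
    [IsFiniteMeasure R] (h : P + R = Q + R) : P = Q := by
  rw [← Measure.add_sub_cancel (μ := P) (ν := R), h, Measure.add_sub_cancel]

/-- Both `μ` and `lebesgueUnit` are invariant, so cancelling the Lebesgue part shows that the
remainder, of mass `1 - a`, is invariant too. -/
lemma IsInvariantOnInterval.sub_smul {N : ℕ} (hN : 1 < N) {μ : Measure ℝ}
    (hμ : IsInvariantOnInterval N μ) {a : ℝ≥0} (ha : a • lebesgueUnit ≤ μ) :
    ∃ ν, IsInvariantOnInterval N ν ∧ μ = (1 - a) • ν + a • lebesgueUnit := by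
  have := hμ.isProbability
  have hadd : μ - a • lebesgueUnit + a • lebesgueUnit = μ := Measure.sub_add_cancel_of_le ha
  suffices h : ∃ ν, IsInvariantOnInterval N ν ∧ μ - a • lebesgueUnit = (1 - a) • ν by
    obtain ⟨ν, hν, h⟩ := h
    exact ⟨ν, hν, by rw [← h, hadd]⟩
  refine exists_eq_smul_isInvariantOnInterval hN ?_ ?_ ?_
  · rw [Measure.sub_apply MeasurableSet.univ ha]
    simp
  · exact le_antisymm ((Measure.sub_le _).trans hμ.carried.le) zero_le
  · refine add_measure_right_cancel (R := a • lebesgueUnit) ?_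
    rw [hadd]
    conv_rhs => rw [← hμ.invariant, ← hadd, Measure.map_add _ _ (measurable_mulModOne N),
      Measure.map_smul, map_mulModOne_lebesgueUnit hN]

theorem IsInvariantOnSquare.mem_convexHull {N : ℕ} (hN : 1 < N) {μ : Measure (ℝ × ℝ)}
    (hμ : IsInvariantOnSquare N μ)
    (h : ∀ p q : ℤ, p ≠ 0 → q ≠ 0 → ∫ x, planeChar p q x ∂μ = 0) :
    μ ∈ convexHull ℝ≥0 (productsWithLebesgue N) := by
  have := hμ.isProbability
  have := hμ.map_fst.isProbability
  have := hμ.map_snd.isProbability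
  have heq := hμ.add_prod_eq h
  obtain ⟨a, ha, h1, h2⟩ := exists_smul_le_of_prod_le
    ((Measure.le_add_left le_rfl).trans_eq heq)
  obtain ⟨ν₁, hν₁, e1⟩ := hμ.map_fst.sub_smul hN h1
  obtain ⟨ν₂, hν₂, e2⟩ := hμ.map_snd.sub_smul hN h2
  have := hν₁.isProbability
  have := hν₂.isProbability
  -- After substituting the decompositions of the marginals, the $\lambda\times\lambda$ terms carry
  -- weights $a$ and $1-a$: exactly the one copy to be cancelled.
  have hμeq : μ = (1 - a) • ν₁.prod lebesgueUnit + a • lebesgueUnit.prod ν₂ := by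
    refine add_measure_right_cancel (R := lebesgueUnit.prod lebesgueUnit) ?_
    have hsum : lebesgueUnit.prod lebesgueUnit =
        a • lebesgueUnit.prod lebesgueUnit + (1 - a) • lebesgueUnit.prod lebesgueUnit := by
      rw [← add_smul, add_tsub_cancel_of_le ha, one_smul]
    rw [heq, e1, e2, tsub_tsub_cancel_of_le ha, Measure.add_prod, Measure.prod_add,
      Measure.prod_smul_left, Measure.prod_smul_left]
    simp only [ENNReal.smul_def, Measure.prod_smul_right] at hsum ⊢
    conv_rhs => rw [hsum]
    abel
  rw [hμeq]
  exact convex_convexHull ℝ≥0 (productsWithLebesgue N) (subset_convexHull _ _ (Or.inl ⟨ν₁, hν₁, rfl⟩))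
    (subset_convexHull _ _ (Or.inr ⟨ν₂, hν₂, rfl⟩)) zero_le zero_le
    (tsub_add_cancel_of_le ha)

/-! ### Finite-valued random variables and the Gibbs inequality -/

lemma integral_comp_eq_sum {Ω E : Type*} [MeasurableSpace Ω] [NormedAddCommGroup E]
    [NormedSpace ℝ E] [CompleteSpace E] {ρ : Measure Ω} [IsFiniteMeasure ρ] {φ : Ω → ℤ}
    (hφ : Measurable φ) {S : Finset ℤ} (hS : ∀ᵐ x ∂ρ, φ x ∈ S) (g : ℤ → E) :
    Integrable (fun x ↦ g (φ x)) ρ ∧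
      ∫ x, g (φ x) ∂ρ = ∑ j ∈ S, ρ.real (φ ⁻¹' {j}) • g j := by
  have hm : ∀ j, MeasurableSet (φ ⁻¹' {j}) := fun j ↦ hφ (measurableSet_singleton j)
  have hi : ∀ j ∈ S, Integrable ((φ ⁻¹' {j}).indicator fun _ ↦ g j) ρ := fun j _ ↦
    (integrable_const _).indicator (hm j)
  have heq : (fun x ↦ g (φ x)) =ᵐ[ρ] fun x ↦ ∑ j ∈ S, (φ ⁻¹' {j}).indicator (fun _ ↦ g j) x := by
    filter_upwards [hS] with x hx
    rw [Finset.sum_eq_single_of_mem _ hx]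
    · simp
    · intro b _ hb
      exact indicator_of_notMem (fun h ↦ hb h.symm) _
  refine ⟨(integrable_finsetSum S hi).congr heq.symm, ?_⟩
  rw [integral_congr_ae heq, integral_finsetSum S hi]
  exact Finset.sum_congr rfl fun j _ ↦ integral_indicator_const _ (hm j)

lemma sum_measureReal_preimage {Ω : Type*} [MeasurableSpace Ω] {ρ : Measure Ω}
    [IsProbabilityMeasure ρ] {φ : Ω → ℤ} (hφ : Measurable φ) {S : Finset ℤ}
    (hS : ∀ᵐ x ∂ρ, φ x ∈ S) : ∑ j ∈ S, ρ.real (φ ⁻¹' {j}) = 1 := by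
  have := (integral_comp_eq_sum hφ hS fun _ ↦ (1 : ℝ)).2
  simpa using this.symm

/-- The Gibbs inequality. -/
lemma sum_neg_mul_logb_le {ι : Type*} {s : Finset ι} {p q : ι → ℝ} (hp : ∀ i ∈ s, 0 ≤ p i)
    (hq : ∀ i ∈ s, 0 ≤ q i) (hpq : ∀ i ∈ s, 0 < p i → 0 < q i)
    (hsum : ∑ i ∈ s, q i ≤ ∑ i ∈ s, p i) :
    ∑ i ∈ s, -(p i * Real.logb 2 (p i)) ≤ ∑ i ∈ s, p i * -Real.logb 2 (q i) := by
  have h2 : 0 < Real.log 2 := Real.log_pos one_lt_two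
  -- This is $\log t\le t-1$ at $t=q_i/p_i$, multiplied by $p_i$.
  have key : ∀ i ∈ s, -(p i * Real.logb 2 (p i)) ≤
      p i * -Real.logb 2 (q i) + (q i - p i) / Real.log 2 := by
    intro i hi
    rcases (hp i hi).eq_or_lt with h0 | h0
    · rw [← h0]
      simpa using div_nonneg (hq i hi) h2.le
    · have hq0 := hpq i hi h0
      have := Real.log_le_sub_one_of_pos (div_pos hq0 h0)
      rw [Real.log_div hq0.ne' h0.ne'] at this
      have h3 := mul_le_mul_of_nonneg_left this h0.le
      have h4 : p i * (q i / p i - 1) = q i - p i := by field_simp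
      rw [h4] at h3
      have h5 := div_le_div_of_nonneg_right h3 h2.le
      simp only [Real.logb]
      have h6 : p i * (Real.log (q i) - Real.log (p i)) / Real.log 2 =
        p i * (Real.log (q i) / Real.log 2) - p i * (Real.log (p i) / Real.log 2) := by ring
      linarith
  refine (Finset.sum_le_sum key).trans ?_
  rw [Finset.sum_add_distrib, ← Finset.sum_div, Finset.sum_sub_distrib]
  have : (∑ i ∈ s, q i - ∑ i ∈ s, p i) / Real.log 2 ≤ 0 :=
    div_nonpos_of_nonpos_of_nonneg (by linarith) h2.le
  linarith

/-- Only the uniform distribution has maximal entropy. -/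
lemma eq_inv_card_of_le_entropy {ι : Type*} {s : Finset ι} {p : ι → ℝ} (hp : ∀ i ∈ s, 0 ≤ p i)
    (hsum : ∑ i ∈ s, p i = 1)
    (h : Real.logb 2 s.card ≤ ∑ i ∈ s, -(p i * Real.logb 2 (p i))) :
    ∀ i ∈ s, p i = (s.card : ℝ)⁻¹ := by
  intro j hj
  have hc : (0 : ℝ) < s.card := Nat.cast_pos.2 (Finset.card_pos.2 ⟨j, hj⟩)
  have h2 : 0 < Real.log 2 := Real.log_pos one_lt_two
  have hlog : Real.log s.card ≤ ∑ i ∈ s, -(p i * Real.log (p i)) := by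
    have h1 := mul_le_mul_of_nonneg_right h h2.le
    rw [Real.logb, div_mul_cancel₀ _ h2.ne', Finset.sum_mul] at h1
    refine h1.trans_eq (Finset.sum_congr rfl fun i _ ↦ ?_)
    rw [Real.logb]; field_simp
  -- Now $t=1/(|s|p_i)$. The right-hand sides sum to $\log|s|$, so every inequality is an equality,
  -- and strictness of $\log t<t-1$ off $t=1$ forces $p_i=1/|s|$.
  have key : ∀ i ∈ s, -(p i * Real.log (p i)) ≤ p i * Real.log s.card + ((s.card : ℝ)⁻¹ - p i) := by
    intro i hi
    rcases (hp i hi).eq_or_lt with h0 | h0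
    · rw [← h0]; simp
    · have := mul_le_mul_of_nonneg_left
        (Real.log_le_sub_one_of_pos (inv_pos.2 (mul_pos hc h0))) h0.le
      rw [Real.log_inv, Real.log_mul hc.ne' h0.ne'] at this
      have h4 : p i * ((s.card * p i)⁻¹ - 1) = (s.card : ℝ)⁻¹ - p i := by field_simp
      linarith
  have htot : ∑ i ∈ s, (p i * Real.log s.card + ((s.card : ℝ)⁻¹ - p i)) = Real.log s.card := by
    rw [Finset.sum_add_distrib, ← Finset.sum_mul, Finset.sum_sub_distrib, hsum]
    simp [hc.ne']
  have heq := (Finset.sum_eq_sum_iff_of_le key).1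
    (le_antisymm (Finset.sum_le_sum key) (htot.trans_le hlog)) j hj
  rcases (hp j hj).eq_or_lt with h0 | h0
  · rw [← h0] at heq
    simp only [zero_mul, neg_zero, zero_add, sub_zero] at heq
    rw [← h0, ← heq]
  · by_contra hne
    have hx : ((s.card : ℝ) * p j)⁻¹ ≠ 1 := by
      intro hx
      apply hne
      rw [inv_eq_one] at hx
      exact eq_inv_of_mul_eq_one_right hx
    have := mul_lt_mul_of_pos_left (Real.log_lt_sub_one_of_pos (inv_pos.2 (mul_pos hc h0)) hx) h0
    rw [Real.log_inv, Real.log_mul hc.ne' h0.ne'] at this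
    have h4 : p j * ((s.card * p j)⁻¹ - 1) = (s.card : ℝ)⁻¹ - p j := by field_simp
    linarith

/-! ### Dyadic entropy of compactly supported measures -/

lemma dyadicInterval_eq_preimage (n : ℕ) (k : ℤ) :
    dyadicInterval n k = (fun x : ℝ ↦ ⌊2 ^ n * x⌋) ⁻¹' {k} := by
  ext x
  have h : (0 : ℝ) < 2 ^ n := by positivity
  rw [dyadicInterval, mem_Ico, mem_preimage, mem_singleton_iff, Int.floor_eq_iff, div_le_iff₀ h,
    lt_div_iff₀ h, mul_comm]

lemma measurable_dyadicFloor (n : ℕ) : Measurable fun x : ℝ ↦ ⌊2 ^ n * x⌋ := by fun_prop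

/-- The indices of the dyadic intervals of level `n` in `[-M, M)`. -/
noncomputable def dyadicIndices (M n : ℕ) : Finset ℤ := Finset.Ico (-(M * 2 ^ n)) (M * 2 ^ n)

lemma card_dyadicIndices (M n : ℕ) : (dyadicIndices M n).card = 2 * M * 2 ^ n := by
  have : ((M : ℤ) * 2 ^ n - -(M * 2 ^ n)) = ((2 * M * 2 ^ n : ℕ) : ℤ) := by push_cast; ring
  rw [dyadicIndices, Int.card_Ico, this, Int.toNat_natCast]

lemma floor_mem_dyadicIndices {M n : ℕ} {x : ℝ} (hx : x ∈ Ico (-M : ℝ) M) :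
    ⌊2 ^ n * x⌋ ∈ dyadicIndices M n := by
  have h : (0 : ℝ) < 2 ^ n := by positivity
  rw [dyadicIndices, Finset.mem_Ico, Int.le_floor, Int.floor_lt]
  push_cast
  constructor
  · have := mul_le_mul_of_nonneg_left hx.1 h.le; linarith
  · have := mul_lt_mul_of_pos_left hx.2 h; linarith

lemma ae_floor_mem_dyadicIndices {ρ : Measure ℝ} {M : ℕ} (hM : ρ (Ico (-M : ℝ) M)ᶜ = 0) (n : ℕ) :
    ∀ᵐ x ∂ρ, ⌊2 ^ n * x⌋ ∈ dyadicIndices M n := by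
  filter_upwards [mem_ae_iff.2 hM] with x hx using floor_mem_dyadicIndices hx

section

variable {ρ : Measure ℝ} [IsProbabilityMeasure ρ] {M : ℕ}

lemma sum_dyadicIndices (hM : ρ (Ico (-M : ℝ) M)ᶜ = 0) (n : ℕ) :
    ∑ k ∈ dyadicIndices M n, ρ.real (dyadicInterval n k) = 1 := by
  simp only [dyadicInterval_eq_preimage]
  exact sum_measureReal_preimage (measurable_dyadicFloor n) (ae_floor_mem_dyadicIndices hM n)

lemma scaleEntropy_eq_ofReal_sum (hM : ρ (Ico (-M : ℝ) M)ᶜ = 0) (n : ℕ) :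
    scaleEntropy n ρ = ENNReal.ofReal (∑ k ∈ dyadicIndices M n,
      -(ρ.real (dyadicInterval n k) * Real.logb 2 (ρ.real (dyadicInterval n k)))) := by
  rw [scaleEntropy, ENNReal.ofReal_sum_of_nonneg]
  · refine tsum_eq_sum fun k hk ↦ ?_
    have : ρ (dyadicInterval n k) = 0 := by
      refine measure_mono_null (t := (Ico (-M : ℝ) M)ᶜ) (fun x hx h ↦ hk ?_) hM
      rw [dyadicInterval_eq_preimage] at hx
      exact hx ▸ floor_mem_dyadicIndices h
    simp [Measure.real, this]
  · intro k _
    rw [← mul_neg]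
    exact mul_nonneg measureReal_nonneg
      (neg_nonneg.2 (Real.logb_nonpos one_lt_two measureReal_nonneg measureReal_le_one))

/-- The Gibbs inequality against the uniform distribution on the $2M2^n$ dyadic intervals. -/
lemma scaleEntropy_le_of_carried (hM : ρ (Ico (-M : ℝ) M)ᶜ = 0) (hM0 : 0 < M) (n : ℕ) :
    scaleEntropy n ρ ≤ ENNReal.ofReal (Real.logb 2 (2 * M) + n) := by
  rw [scaleEntropy_eq_ofReal_sum hM]
  have hc : (0 : ℝ) < 2 * M * 2 ^ n := by positivity
  refine ENNReal.ofReal_le_ofReal ((sum_neg_mul_logb_le (q := fun _ ↦ (2 * M * 2 ^ n : ℝ)⁻¹)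
    (fun _ _ ↦ measureReal_nonneg) (fun _ _ ↦ (inv_pos.2 hc).le)
    (fun _ _ _ ↦ inv_pos.2 hc) ?_).trans_eq ?_)
  · rw [sum_dyadicIndices hM, Finset.sum_const, card_dyadicIndices, nsmul_eq_mul]
    push_cast
    rw [mul_inv_cancel₀ hc.ne']
  · rw [← Finset.sum_mul, sum_dyadicIndices hM, one_mul, Real.logb_inv, neg_neg,
      Real.logb_mul (by positivity) (by positivity), Real.logb_pow, Real.logb_self_eq_one one_lt_two,
      mul_one]

/-- Each dyadic interval has mass at most $C2^{-n}$, so its information is at least $n-\log_2 C$;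
then average. -/
lemma le_scaleEntropy_of_le_smul_volume (hM : ρ (Ico (-M : ℝ) M)ᶜ = 0) {C : ℝ≥0} (hC0 : 0 < C)
    (hC : ρ ≤ C • volume) (n : ℕ) :
    ENNReal.ofReal (n - Real.logb 2 C) ≤ scaleEntropy n ρ := by
  rw [scaleEntropy_eq_ofReal_sum hM]
  refine ENNReal.ofReal_le_ofReal ?_
  have key : ∀ k ∈ dyadicIndices M n, ρ.real (dyadicInterval n k) * (n - Real.logb 2 C) ≤
      -(ρ.real (dyadicInterval n k) * Real.logb 2 (ρ.real (dyadicInterval n k))) := by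
    intro k _
    rcases (measureReal_nonneg (μ := ρ) (s := dyadicInterval n k)).eq_or_lt with h0 | h0
    · simp [← h0]
    have hC0' : (0 : ℝ) < C := hC0
    have hle : ρ.real (dyadicInterval n k) ≤ C / 2 ^ n := by
      have h1 := hC (dyadicInterval n k)
      have h2 : ((k : ℝ) + 1) / 2 ^ n - k / 2 ^ n = 1 / 2 ^ n := by ring
      rw [Measure.smul_apply, dyadicInterval, Real.volume_Ico, h2, ENNReal.smul_def, smul_eq_mul] at h1
      have h3 := ENNReal.toReal_mono (by finiteness) h1
      rw [ENNReal.toReal_mul, ENNReal.toReal_ofReal (by positivity)] at h3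
      simpa [Measure.real, dyadicInterval, div_eq_mul_inv] using h3
    have hlog := Real.logb_le_logb_of_le one_lt_two h0 hle
    rw [Real.logb_div hC0'.ne' (by positivity), Real.logb_pow, Real.logb_self_eq_one one_lt_two,
      mul_one] at hlog
    rw [← mul_neg]
    exact mul_le_mul_of_nonneg_left (by linarith) h0.le
  refine le_trans (le_of_eq ?_) (Finset.sum_le_sum key)
  rw [← Finset.sum_mul, sum_dyadicIndices hM, one_mul]

lemma tendsto_ofReal_affine_div (a b : ℝ) :
    Tendsto (fun n : ℕ ↦ ENNReal.ofReal (a * n + b) / (n : ℝ≥0∞)) atTop (nhds (ENNReal.ofReal a)) := by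
  have h : Tendsto (fun n : ℕ ↦ a + b / n) atTop (nhds (a + 0)) :=
    tendsto_const_nhds.add (tendsto_const_div_atTop_nhds_zero_nat b)
  rw [add_zero] at h
  refine (ENNReal.tendsto_ofReal h).congr' ?_
  filter_upwards [eventually_gt_atTop 0] with n hn
  have hn' : (0 : ℝ) < n := Nat.cast_pos.2 hn
  rw [← ENNReal.ofReal_natCast, ← ENNReal.ofReal_div_of_pos hn']
  congr 1
  field_simp

theorem entropyDim_eq_one_of_le_smul_volume (hM : ρ (Ico (-M : ℝ) M)ᶜ = 0) {C : ℝ≥0}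
    (hC : ρ ≤ C • volume) : entropyDim ρ = 1 := by
  have hC0 : 0 < C := by
    refine pos_of_ne_zero fun h ↦ ?_
    have := hC univ
    simp [h] at this
  have hM0 : 0 < M := by
    refine Nat.pos_of_ne_zero fun h ↦ ?_
    simp [h] at hM
  have h1 := tendsto_ofReal_affine_div 1 (-Real.logb 2 C)
  have h2 := tendsto_ofReal_affine_div 1 (Real.logb 2 (2 * M))
  rw [ENNReal.ofReal_one] at h1 h2
  refine (tendsto_of_tendsto_of_tendsto_of_le_of_le h1 h2 (fun n ↦ ?_) fun n ↦ ?_).liminf_eq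
  · refine ENNReal.div_le_div_right ?_ _
    rw [one_mul, ← sub_eq_add_neg]
    exact le_scaleEntropy_of_le_smul_volume hM hC0 hC n
  · refine ENNReal.div_le_div_right ?_ _
    rw [one_mul, add_comm]
    exact scaleEntropy_le_of_carried hM hM0 n

end

/-! ### Digits in base `B` -/

/-- The first digit of the fractional part of `x` in base `B`. -/
noncomputable def digit (B : ℕ) (x : ℝ) : ℤ := ⌊B * Int.fract x⌋

/-- The digits in base `B`. -/
def digitSet (B : ℕ) : Finset ℤ := (Finset.range B).map Nat.castEmbedding

lemma card_digitSet (B : ℕ) : (digitSet B).card = B := by simp [digitSet]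

@[fun_prop]
lemma measurable_digit (B : ℕ) : Measurable (digit B) := by
  unfold digit; fun_prop

lemma digit_mem (B : ℕ) (hB : 0 < B) (x : ℝ) : digit B x ∈ digitSet B := by
  have hB' : (0 : ℝ) < B := Nat.cast_pos.2 hB
  have h0 : 0 ≤ digit B x := Int.floor_nonneg.2 (mul_nonneg hB'.le (Int.fract_nonneg x))
  have h1 : digit B x < B := by
    rw [digit, Int.floor_lt]
    have := mul_lt_mul_of_pos_left (Int.fract_lt_one x) hB'
    simpa using this
  refine Finset.mem_map.2 ⟨(digit B x).toNat, Finset.mem_range.2 (by omega), ?_⟩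
  simpa using h0

lemma fract_nat_mul (B : ℕ) (x : ℝ) : Int.fract (B * x) = B * Int.fract x - digit B x := by
  have : (B : ℝ) * x = B * Int.fract x + ((B * ⌊x⌋ : ℤ) : ℝ) := by
    rw [Int.fract]; push_cast; ring
  rw [this, Int.fract_add_intCast, digit, Int.self_sub_floor]

/-- Points with the same first `k` digits are close modulo one. -/
lemma abs_fract_sub_fract_lt {B : ℕ} (k : ℕ) {x y : ℝ}
    (h : ∀ i < k, digit B (B ^ i * x) = digit B (B ^ i * y)) :
    B ^ k * |Int.fract x - Int.fract y| < 1 := by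
  induction k generalizing x y with
  | zero =>
    rw [pow_zero, one_mul, abs_lt]
    constructor <;>
      linarith [Int.fract_nonneg x, Int.fract_lt_one x, Int.fract_nonneg y, Int.fract_lt_one y]
  | succ k ih =>
    have h1 := ih (x := B * x) (y := B * y) fun i hi ↦ by
      have := h (i + 1) (by omega)
      rwa [pow_succ, mul_assoc, mul_assoc] at this
    have h0 := h 0 (by omega)
    simp only [pow_zero, one_mul] at h0
    rw [fract_nat_mul, fract_nat_mul, h0, sub_sub_sub_cancel_right, ← mul_sub, abs_mul,
      Nat.abs_cast, ← mul_assoc, ← pow_succ] at h1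
    exact h1

open Classical in
/-- A word of `k` digits in base `B` meets boundedly many dyadic intervals of length at least
`B⁻ᵏ` in `[-M, M)`. -/
lemma card_filter_dyadicIndices_le {B M n k : ℕ} (hnk : 2 ^ n ≤ B ^ k) (w : Fin k → ℤ) :
    ((dyadicIndices M n).filter fun j ↦ ∃ x ∈ Ico (-M : ℝ) M, ⌊2 ^ n * x⌋ = j ∧
      ∀ i : Fin k, digit B (B ^ (i : ℕ) * x) = w i).card ≤ 6 * M := by
  rcases Finset.eq_empty_or_nonempty ((dyadicIndices M n).filter fun j ↦ ∃ x ∈ Ico (-M : ℝ) M,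
      ⌊2 ^ n * x⌋ = j ∧ ∀ i : Fin k, digit B (B ^ (i : ℕ) * x) = w i) with h | ⟨j₀, hj₀⟩
  · rw [h]; simp
  obtain ⟨-, y, -, -, hy⟩ := Finset.mem_filter.1 hj₀
  -- An index is determined by $\lfloor x\rfloor\in[-M,M)$, with $2M$ choices, and by the dyadic
  -- index of the fractional part, within 1 of `c`: 3 choices. Hence $6M$.
  let c : ℤ := ⌊2 ^ n * Int.fract y⌋
  have hsub : ((dyadicIndices M n).filter fun j ↦ ∃ x ∈ Ico (-M : ℝ) M, ⌊2 ^ n * x⌋ = j ∧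
      ∀ i : Fin k, digit B (B ^ (i : ℕ) * x) = w i) ⊆
      Finset.image₂ (fun t d : ℤ ↦ 2 ^ n * t + d) (Finset.Ico (-M : ℤ) M)
        (Finset.Icc (c - 1) (c + 1)) := by
    intro j hj
    obtain ⟨-, x, hxM, hxj, hx⟩ := Finset.mem_filter.1 hj
    have hclose := abs_fract_sub_fract_lt (B := B) k (x := x) (y := y) fun i hi ↦
      (hx ⟨i, hi⟩).trans (hy ⟨i, hi⟩).symm
    have hclose' : (2 : ℝ) ^ n * |Int.fract x - Int.fract y| < 1 :=
      (mul_le_mul_of_nonneg_right (by exact_mod_cast hnk) (abs_nonneg _)).trans_lt hclose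
    rw [← abs_of_pos (show (0 : ℝ) < 2 ^ n by positivity), ← abs_mul, mul_sub, abs_lt] at hclose'
    refine Finset.mem_image₂.2 ⟨⌊x⌋, ?_, ⌊2 ^ n * Int.fract x⌋, ?_, ?_⟩
    · rw [Finset.mem_Ico, Int.le_floor, Int.floor_lt]
      push_cast
      exact hxM
    · have h1 := Int.floor_le (2 ^ n * Int.fract x)
      have h2 := Int.lt_floor_add_one (2 ^ n * Int.fract x)
      have h3 := Int.floor_le (2 ^ n * Int.fract y)
      have h4 := Int.lt_floor_add_one (2 ^ n * Int.fract y)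
      have h5 : ((c - 2 : ℤ) : ℝ) < (⌊2 ^ n * Int.fract x⌋ : ℤ) := by
        simp only [c]; push_cast; linarith
      have h6 : ((⌊2 ^ n * Int.fract x⌋ : ℤ) : ℝ) < (c + 2 : ℤ) := by
        simp only [c]; push_cast; linarith
      rw [Int.cast_lt] at h5 h6
      rw [Finset.mem_Icc]
      omega
    · rw [← hxj]
      have : (2 : ℝ) ^ n * x = ((2 ^ n * ⌊x⌋ : ℤ) : ℝ) + 2 ^ n * Int.fract x := by
        rw [Int.fract]; push_cast; ring
      rw [this, Int.floor_intCast_add]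
  refine (Finset.card_le_card hsub).trans ((Finset.card_image₂_le _ _ _).trans ?_)
  rw [Int.card_Ico, Int.card_Icc]
  have e1 : ((M : ℤ) - -M).toNat = 2 * M := by omega
  have e2 : (c + 1 + 1 - (c - 1)).toNat = 3 := by omega
  rw [e1, e2]
  omega

/-! ### Entropy of measures whose fractional part is invariant -/

lemma map_fract_pow_mul {N : ℕ} {ρ : Measure ℝ}
    (h : ρ.map (fun x : ℝ ↦ Int.fract (N * x)) = ρ.map Int.fract) (i : ℕ) :
    ρ.map (fun x : ℝ ↦ Int.fract (N ^ i * x)) = ρ.map Int.fract := by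
  have hcomm : ∀ y : ℝ, Int.fract (N * Int.fract y) = Int.fract (N * y) := fun y ↦ by
    rw [Int.fract_eq_fract]
    exact ⟨-(N * ⌊y⌋), by rw [Int.fract]; push_cast; ring⟩
  induction i with
  | zero => simp
  | succ i ih =>
    have h1 : (fun x : ℝ ↦ Int.fract (N ^ (i + 1) * x)) =
        (fun y : ℝ ↦ Int.fract (N * y)) ∘ fun x : ℝ ↦ Int.fract (N ^ i * x) := by
      funext x
      rw [Function.comp_apply, hcomm, pow_succ', mul_assoc]
    have h2 : (fun y : ℝ ↦ Int.fract (N * y)) ∘ Int.fract = fun x : ℝ ↦ Int.fract (N * x) :=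
      funext hcomm
    rw [h1, ← Measure.map_map (by fun_prop) (by fun_prop), ih,
      Measure.map_map (by fun_prop) (by fun_prop), h2, h]

/-- A digit depends only on the fractional part, whose law is the same after multiplication by any
power of `B`. -/
lemma measureReal_digit_pow_mul {B : ℕ} {ρ : Measure ℝ}
    (h : ρ.map (fun x : ℝ ↦ Int.fract (B * x)) = ρ.map Int.fract) (i : ℕ) (b : ℤ) :
    ρ.real ((fun x ↦ digit B (B ^ i * x)) ⁻¹' {b}) = ρ.real (digit B ⁻¹' {b}) := by
  have hm : MeasurableSet ((fun y : ℝ ↦ ⌊(B : ℝ) * y⌋) ⁻¹' {b}) :=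
    (show Measurable fun y : ℝ ↦ ⌊(B : ℝ) * y⌋ by fun_prop) (measurableSet_singleton b)
  have h1 := congrArg (fun ν : Measure ℝ ↦ ν.real ((fun y : ℝ ↦ ⌊(B : ℝ) * y⌋) ⁻¹' {b}))
    (map_fract_pow_mul h i)
  rw [map_measureReal_apply (by fun_prop) hm, map_measureReal_apply (by fun_prop) hm] at h1
  exact h1

section

variable {ρ : Measure ℝ} [IsProbabilityMeasure ρ] {M B : ℕ}

/-- The Shannon entropy of the first digit. -/
noncomputable def digitEntropy (B : ℕ) (ρ : Measure ℝ) : ℝ :=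
  ∑ b ∈ digitSet B, -(ρ.real (digit B ⁻¹' {b}) * Real.logb 2 (ρ.real (digit B ⁻¹' {b})))

lemma digitEntropy_nonneg (B : ℕ) (ρ : Measure ℝ) [IsProbabilityMeasure ρ] :
    0 ≤ digitEntropy B ρ := Finset.sum_nonneg fun b _ ↦ by
  rw [← mul_neg]
  exact mul_nonneg measureReal_nonneg
    (neg_nonneg.2 (Real.logb_nonpos one_lt_two measureReal_nonneg measureReal_le_one))

lemma sum_digitSet (hB : 0 < B) : ∑ b ∈ digitSet B, ρ.real (digit B ⁻¹' {b}) = 1 :=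
  sum_measureReal_preimage (measurable_digit B) (Eventually.of_forall (digit_mem B hB))

/-- The dyadic entropy is bounded by the entropy of independent digits. -/
lemma scaleEntropy_le_digitEntropy (hM : ρ (Ico (-M : ℝ) M)ᶜ = 0) (hM0 : 0 < M) (hB : 0 < B)
    (hinv : ρ.map (fun x : ℝ ↦ Int.fract (B * x)) = ρ.map Int.fract) {n k : ℕ} (hnk : 2 ^ n ≤ B ^ k) :
    scaleEntropy n ρ ≤ ENNReal.ofReal (Real.logb 2 (6 * M) + k * digitEntropy B ρ) := by
  classical
  let f : ℤ → ℝ := fun b ↦ ρ.real (digit B ⁻¹' {b})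
  have hf0 : ∀ b, 0 ≤ f b := fun b ↦ measureReal_nonneg
  let R : ℤ → (Fin k → ℤ) → Prop := fun j w ↦ ∃ x ∈ Ico (-M : ℝ) M, ⌊2 ^ n * x⌋ = j ∧
    ∀ i : Fin k, digit B (B ^ (i : ℕ) * x) = w i
  let W : Finset (Fin k → ℤ) := Fintype.piFinset fun _ ↦ digitSet B
  let F : (Fin k → ℤ) → ℝ := fun w ↦ ∏ i, f (w i)
  have hF0 : ∀ w, 0 ≤ F w := fun w ↦ Finset.prod_nonneg fun i _ ↦ hf0 _
  have hFsum : ∑ w ∈ W, F w = 1 := by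
    rw [← Finset.prod_univ_sum]
    simp [f, sum_digitSet hB]
  -- The comparison weights for Gibbs: `F` is the law of independent digits, and each word is
  -- charged to every interval it meets. There are at most `6 * M` of these, so the total is at most
  -- 1.
  let q : ℤ → ℝ := fun j ↦ (∑ w ∈ W.filter (R j), F w) / (6 * M)
  have hK : (0 : ℝ) < 6 * M := by positivity
  have hq0 : ∀ j, 0 ≤ q j := fun j ↦ div_nonneg (Finset.sum_nonneg fun w _ ↦ hF0 w) hK.le
  have hqsum : ∑ j ∈ dyadicIndices M n, q j ≤ 1 := by
    rw [← Finset.sum_div, div_le_one hK]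
    calc ∑ j ∈ dyadicIndices M n, ∑ w ∈ W.filter (R j), F w
        = ∑ w ∈ W, ∑ j ∈ (dyadicIndices M n).filter (fun j ↦ R j w), F w := by
          simp only [Finset.sum_filter]
          exact Finset.sum_comm
      _ ≤ ∑ w ∈ W, (6 * M) * F w := by
          refine Finset.sum_le_sum fun w _ ↦ ?_
          rw [Finset.sum_const, nsmul_eq_mul]
          refine mul_le_mul_of_nonneg_right ?_ (hF0 w)
          have hcard : ((dyadicIndices M n).filter fun j ↦ R j w).card ≤ 6 * M :=
            card_filter_dyadicIndices_le hnk w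
          exact_mod_cast hcard
      _ = 6 * M := by rw [← Finset.mul_sum, hFsum, mul_one]
  let D : ℝ → Fin k → ℤ := fun x i ↦ digit B (B ^ (i : ℕ) * x)
  have hDm : ∀ i : ℕ, Measurable fun x : ℝ ↦ digit B (B ^ i * x) := fun i ↦ by fun_prop
  -- Digits of probability zero almost surely never occur; this makes `q` positive wherever `ρ` is.
  have hpos : ∀ᵐ x ∂ρ, ∀ i : Fin k, 0 < f (D x i) := by
    refine ae_all_iff.2 fun i ↦ ?_
    have hnull : ∀ b : ℤ, ρ {x | D x i = b ∧ f b = 0} = 0 := by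
      intro b
      by_cases hb : f b = 0
      · have h1 := (measureReal_digit_pow_mul hinv i b).trans hb
        rw [measureReal_eq_zero_iff] at h1
        exact measure_mono_null (fun x hx ↦ hx.1) h1
      · simp [hb]
    refine measure_mono_null (fun x hx ↦ ?_) (measure_iUnion_null hnull)
    exact mem_iUnion.2 ⟨D x i, rfl, le_antisymm (not_lt.1 hx) (hf0 _)⟩
  have hqle : ∀ᵐ x ∂ρ, 0 < F (D x) ∧ F (D x) / (6 * M) ≤ q ⌊2 ^ n * x⌋ := by
    filter_upwards [hpos, mem_ae_iff.2 hM] with x hx hxM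
    refine ⟨Finset.prod_pos fun i _ ↦ hx i, div_le_div_of_nonneg_right ?_ hK.le⟩
    refine Finset.single_le_sum (f := F) (fun w _ ↦ hF0 w) (Finset.mem_filter.2 ⟨?_, ?_⟩)
    · exact Fintype.mem_piFinset.2 fun i ↦ digit_mem B hB _
    · exact ⟨x, hxM, rfl, fun i ↦ rfl⟩
  have hpq : ∀ j ∈ dyadicIndices M n, 0 < ρ.real (dyadicInterval n j) → 0 < q j := by
    intro j _ hj
    have hj' : ρ (dyadicInterval n j) ≠ 0 := fun h ↦ by simp [Measure.real, h] at hj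
    obtain ⟨x, hxj, hx1, hx2⟩ := Measure.exists_mem_of_measure_ne_zero_of_ae hj' (ae_restrict_of_ae hqle)
    rw [dyadicInterval_eq_preimage] at hxj
    have : ⌊2 ^ n * x⌋ = j := hxj
    exact this ▸ (div_pos hx1 hK).trans_le hx2
  rw [scaleEntropy_eq_ofReal_sum hM]
  refine ENNReal.ofReal_le_ofReal ((sum_neg_mul_logb_le (fun _ _ ↦ measureReal_nonneg)
    (fun j _ ↦ hq0 j) hpq (hqsum.trans_eq (sum_dyadicIndices hM n).symm)).trans ?_)
  -- The Gibbs bound is the mean of $-\log_2 q$. Since $q\ge F/(6M)$ along the digits of $x$ and $F$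
  -- is a product, it splits into one term per digit, each of mean `digitEntropy B ρ`. Independence
  -- of the digits under `ρ` plays no role.
  have hint := integral_comp_eq_sum (measurable_dyadicFloor n) (ae_floor_mem_dyadicIndices hM n)
    fun j ↦ -Real.logb 2 (q j)
  have hlhs : ∑ j ∈ dyadicIndices M n, ρ.real (dyadicInterval n j) * -Real.logb 2 (q j) =
      ∫ x, -Real.logb 2 (q ⌊2 ^ n * x⌋) ∂ρ := by
    rw [hint.2]
    simp only [dyadicInterval_eq_preimage, smul_eq_mul]
  have hdig : ∀ i : Fin k, Integrable (fun x ↦ -Real.logb 2 (f (D x i))) ρ ∧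
      ∫ x, -Real.logb 2 (f (D x i)) ∂ρ = digitEntropy B ρ := by
    intro i
    have h1 := integral_comp_eq_sum (hDm i) (S := digitSet B)
      (Eventually.of_forall fun x ↦ digit_mem B hB _) (ρ := ρ) fun b ↦ -Real.logb 2 (f b)
    refine ⟨h1.1, h1.2.trans (Finset.sum_congr rfl fun b _ ↦ ?_)⟩
    rw [measureReal_digit_pow_mul hinv, smul_eq_mul, mul_neg]
  have hsumint : Integrable (fun x ↦ ∑ i : Fin k, -Real.logb 2 (f (D x i))) ρ :=
    integrable_finsetSum _ fun i _ ↦ (hdig i).1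
  have hrhs : ∫ x, (Real.logb 2 (6 * M) + ∑ i : Fin k, -Real.logb 2 (f (D x i))) ∂ρ =
      Real.logb 2 (6 * M) + k * digitEntropy B ρ := by
    rw [integral_add (integrable_const _) hsumint, integral_finsetSum _ fun i _ ↦ (hdig i).1]
    simp [fun i ↦ (hdig i).2]
  rw [hlhs, ← hrhs]
  refine integral_mono_ae hint.1 ((integrable_const _).add hsumint) ?_
  filter_upwards [hpos, hqle] with x hx hx'
  have h1 := Real.logb_le_logb_of_le one_lt_two (div_pos hx'.1 hK) hx'.2
  rw [Real.logb_div hx'.1.ne' hK.ne', Real.logb_prod _ _ (fun i _ ↦ (hx i).ne')] at h1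
  rw [Finset.sum_neg_distrib]
  linarith

/-- About $n/\log_2 B$ digits resolve scale $2^{-n}$, so dividing the entropy bound by $n$ bounds
the dimension by digit entropy over $\log_2 B$. -/
lemma le_digitEntropy_of_entropyDim_eq_one (hM : ρ (Ico (-M : ℝ) M)ᶜ = 0) (hM0 : 0 < M)
    (hB : 1 < B) (hinv : ρ.map (fun x : ℝ ↦ Int.fract (B * x)) = ρ.map Int.fract)
    (hdim : entropyDim ρ = 1) : Real.logb 2 B ≤ digitEntropy B ρ := by
  have hB1 : (1 : ℝ) < B := Nat.one_lt_cast.2 hB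
  have hL : 0 < Real.logb 2 B := Real.logb_pos one_lt_two hB1
  have hH := digitEntropy_nonneg B ρ
  have hle : ∀ n : ℕ, scaleEntropy n ρ ≤ ENNReal.ofReal
      (digitEntropy B ρ / Real.logb 2 B * n + (Real.logb 2 (6 * M) + digitEntropy B ρ)) := by
    intro n
    refine (scaleEntropy_le_digitEntropy hM hM0 (by omega) hinv (k := Nat.clog B (2 ^ n))
      (Nat.le_pow_clog hB _)).trans (ENNReal.ofReal_le_ofReal ?_)
    have hk : (Nat.clog B (2 ^ n) : ℝ) ≤ n / Real.logb 2 B + 1 := by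
      rcases Nat.eq_zero_or_pos n with rfl | hn
      · simp
      have h1 : B ^ (Nat.clog B (2 ^ n) - 1) < 2 ^ n :=
        Nat.pow_pred_clog_lt_self hB (Nat.one_lt_two_pow hn.ne')
      have h2 : (B : ℝ) ^ (Nat.clog B (2 ^ n) - 1) ≤ 2 ^ n := by exact_mod_cast h1.le
      have h3 := Real.logb_le_logb_of_le one_lt_two (by positivity) h2
      rw [Real.logb_pow, Real.logb_pow, Real.logb_self_eq_one one_lt_two, mul_one,
        ← le_div_iff₀ hL] at h3
      have h4 : (Nat.clog B (2 ^ n) : ℝ) ≤ ((Nat.clog B (2 ^ n) - 1 : ℕ) : ℝ) + 1 := by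
        exact_mod_cast (by omega)
      linarith
    have := mul_le_mul_of_nonneg_right hk hH
    have e : (n / Real.logb 2 B + 1) * digitEntropy B ρ =
      digitEntropy B ρ / Real.logb 2 B * n + digitEntropy B ρ := by ring
    linarith
  have h1 : entropyDim ρ ≤ ENNReal.ofReal (digitEntropy B ρ / Real.logb 2 B) := by
    rw [← (tendsto_ofReal_affine_div _ (Real.logb 2 (6 * M) + digitEntropy B ρ)).liminf_eq]
    exact liminf_le_liminf (Eventually.of_forall fun n ↦ ENNReal.div_le_div_right (hle n) _)
  rw [hdim, ENNReal.one_le_ofReal, one_le_div hL] at h1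
  exact h1

lemma measureReal_digit_eq_inv (hM : ρ (Ico (-M : ℝ) M)ᶜ = 0) (hM0 : 0 < M)
    (hB : 1 < B) (hinv : ρ.map (fun x : ℝ ↦ Int.fract (B * x)) = ρ.map Int.fract)
    (hdim : entropyDim ρ = 1) : ∀ b ∈ digitSet B, ρ.real (digit B ⁻¹' {b}) = (B : ℝ)⁻¹ := by
  have h := eq_inv_card_of_le_entropy (s := digitSet B) (p := fun b ↦ ρ.real (digit B ⁻¹' {b}))
    (fun _ _ ↦ measureReal_nonneg) (sum_digitSet (by omega)) (by
      rw [card_digitSet]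
      exact le_digitEntropy_of_entropyDim_eq_one hM hM0 hB hinv hdim)
  rwa [card_digitSet] at h

lemma integral_exp_digit_eq_zero (hB : 1 < B)
    (h : ∀ b ∈ digitSet B, ρ.real (digit B ⁻¹' {b}) = (B : ℝ)⁻¹) :
    ∫ x, Complex.exp (2 * Real.pi * Complex.I * (digit B x / B : ℝ)) ∂ρ = 0 := by
  rw [(integral_comp_eq_sum (measurable_digit B) (S := digitSet B)
    (Eventually.of_forall (digit_mem B (by omega)))
    fun b ↦ Complex.exp (2 * Real.pi * Complex.I * (b / B : ℝ))).2,
    Finset.sum_congr rfl fun b hb ↦ by rw [h b hb], ← Finset.smul_sum, digitSet, Finset.sum_map]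
  have hroot := (Complex.isPrimitiveRoot_exp B (by omega)).geom_sum_eq_zero hB
  refine (congrArg (fun z : ℂ ↦ (B : ℝ)⁻¹ • z) (Eq.trans ?_ hroot)).trans (smul_zero _)
  refine Finset.sum_congr rfl fun b _ ↦ ?_
  rw [← Complex.exp_nat_mul]
  congr 1
  simp
  ring

/-- A measure of entropy dimension one with `× N`-invariant fractional part has vanishing first
Fourier coefficient. -/
theorem integral_exp_eq_zero_of_entropyDim_eq_one {N : ℕ} (hN : 1 < N)
    (hM : ρ (Ico (-M : ℝ) M)ᶜ = 0) (hM0 : 0 < M)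
    (hinv : ρ.map (fun x : ℝ ↦ Int.fract (N * x)) = ρ.map Int.fract) (hdim : entropyDim ρ = 1) :
    ∫ x, Complex.exp (2 * Real.pi * Complex.I * (x : ℝ)) ∂ρ = 0 := by
  have hnorm : ∀ t : ℝ, ‖Complex.exp (2 * Real.pi * Complex.I * t)‖ = 1 := by
    intro t
    have : (2 * Real.pi * Complex.I * t : ℂ) = ((2 * Real.pi * t : ℝ) : ℂ) * Complex.I := by
      push_cast; ring
    rw [this, Complex.norm_exp_ofReal_mul_I]
  have hfract : ∀ x : ℝ, Complex.exp (2 * Real.pi * Complex.I * (Int.fract x : ℝ)) =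
      Complex.exp (2 * Real.pi * Complex.I * (x : ℝ)) := by
    intro x
    have : (2 * Real.pi * Complex.I * (x : ℝ) : ℂ) =
        2 * Real.pi * Complex.I * (Int.fract x : ℝ) + ⌊x⌋ * (2 * Real.pi * Complex.I) := by
      rw [Int.fract]; push_cast; ring
    rw [this, Complex.exp_add, Complex.exp_int_mul_two_pi_mul_I, mul_one]
  -- The exponent `m + 1` keeps the base above 1.
  have hzero : ∀ m : ℕ, ∫ x, Complex.exp
      (2 * Real.pi * Complex.I * (digit (N ^ (m + 1)) x / (N ^ (m + 1) : ℕ) : ℝ)) ∂ρ = 0 := by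
    intro m
    have hB : 1 < N ^ (m + 1) := Nat.one_lt_pow (by omega) hN
    refine integral_exp_digit_eq_zero hB (measureReal_digit_eq_inv hM hM0 hB ?_ hdim)
    have := map_fract_pow_mul hinv (m + 1)
    push_cast
    exact this
  -- The first digit divided by the base approximates the fractional part to within the inverse of
  -- the base.
  have hlim : ∀ x : ℝ, Tendsto (fun m : ℕ ↦ (digit (N ^ (m + 1)) x / (N ^ (m + 1) : ℕ) : ℝ)) atTop
      (nhds (Int.fract x)) := by
    intro x
    have hBlim : Tendsto (fun m : ℕ ↦ ((N ^ (m + 1) : ℕ) : ℝ)⁻¹) atTop (nhds 0) :=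
      tendsto_inv_atTop_zero.comp (tendsto_natCast_atTop_atTop.comp
        ((tendsto_pow_atTop_atTop_of_one_lt hN).comp (tendsto_add_atTop_nat 1)))
    have hlow : Tendsto (fun m : ℕ ↦ Int.fract x - ((N ^ (m + 1) : ℕ) : ℝ)⁻¹) atTop
        (nhds (Int.fract x)) := by
      simpa using tendsto_const_nhds.sub hBlim
    refine tendsto_of_tendsto_of_tendsto_of_le_of_le hlow tendsto_const_nhds (fun m ↦ ?_) fun m ↦ ?_
    all_goals
      have hB : (0 : ℝ) < (N ^ (m + 1) : ℕ) := by positivity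
      simp only [digit]
    · rw [le_div_iff₀ hB, sub_mul, inv_mul_cancel₀ hB.ne', mul_comm]
      exact (Int.sub_one_lt_floor _).le
    · rw [div_le_iff₀ hB, mul_comm (Int.fract x)]
      exact Int.floor_le _
  have hconv := tendsto_integral_of_dominated_convergence (μ := ρ)
    (F := fun (m : ℕ) x ↦ Complex.exp
      (2 * Real.pi * Complex.I * (digit (N ^ (m + 1)) x / (N ^ (m + 1) : ℕ) : ℝ)))
    (f := fun x ↦ Complex.exp (2 * Real.pi * Complex.I * (Int.fract x : ℝ))) (fun _ ↦ 1)
    (fun m ↦ by fun_prop)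
    (integrable_const _) (fun m ↦ Eventually.of_forall fun x ↦ (hnorm _).le)
    (Eventually.of_forall fun x ↦ by
      have hc : Continuous fun t : ℝ ↦ Complex.exp (2 * Real.pi * Complex.I * t) := by fun_prop
      exact (hc.tendsto _).comp (hlim x))
  simp only [hzero, hfract] at hconv
  exact tendsto_nhds_unique hconv tendsto_const_nhds

end

/-! ### Projections -/

@[fun_prop]
lemma measurable_proj (v : ℝ × ℝ) : Measurable (proj v) := by
  unfold proj; fun_prop

lemma exists_map_proj_compl_Ico_eq_zero (v : ℝ × ℝ) :
    ∃ M : ℕ, 0 < M ∧ ∀ μ : Measure (ℝ × ℝ), μ (Icc 0 1 ×ˢ Icc 0 1)ᶜ = 0 →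
      (μ.map (proj v)) (Ico (-M : ℝ) M)ᶜ = 0 := by
  obtain ⟨M, hM⟩ := exists_nat_gt (|v.1| + |v.2|)
  refine ⟨M, ?_, fun μ hμ ↦ ?_⟩
  · exact_mod_cast (by positivity : (0 : ℝ) ≤ |v.1| + |v.2|).trans_lt hM
  · rw [Measure.map_apply (measurable_proj v) measurableSet_Ico.compl]
    refine measure_mono_null ?_ hμ
    intro x hx h
    obtain ⟨⟨h1, h2⟩, h3, h4⟩ := h
    have hle : |proj v x| ≤ |v.1| + |v.2| := by
      refine (abs_add_le _ _).trans (add_le_add ?_ ?_)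
      · rw [abs_mul, abs_of_nonneg h1]
        exact mul_le_of_le_one_left (abs_nonneg _) h2
      · rw [abs_mul, abs_of_nonneg h3]
        exact mul_le_of_le_one_left (abs_nonneg _) h4
    have := abs_lt.1 (hle.trans_lt hM)
    exact hx ⟨this.1.le, this.2⟩

/-- By Fubini: on each fibre, $y\mapsto xv_1+yv_2$ multiplies Lebesgue measure by $1/|v_2|$. -/
lemma map_proj_prod_lebesgueUnit_le (μ : Measure ℝ) [IsProbabilityMeasure μ] {v : ℝ × ℝ}
    (hv : v.2 ≠ 0) :
    (μ.prod lebesgueUnit).map (proj v) ≤ ENNReal.ofReal |v.2⁻¹| • volume := by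
  refine Measure.le_iff.2 fun A hA ↦ ?_
  rw [Measure.map_apply (measurable_proj v) hA, Measure.prod_apply (measurable_proj v hA)]
  refine (lintegral_mono (g := fun _ ↦ ENNReal.ofReal |v.2⁻¹| * volume A) fun x ↦ ?_).trans_eq
    (by simp)
  refine (Measure.restrict_apply_le _ _).trans_eq ?_
  have : Prod.mk x ⁻¹' (proj v ⁻¹' A) = (fun y ↦ y * v.2) ⁻¹' ((fun z ↦ x * v.1 + z) ⁻¹' A) := rfl
  rw [this, Real.volume_preimage_mul_right hv, measure_preimage_add]

lemma map_proj_lebesgueUnit_prod_le (μ : Measure ℝ) [IsProbabilityMeasure μ] {v : ℝ × ℝ}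
    (hv : v.1 ≠ 0) :
    (lebesgueUnit.prod μ).map (proj v) ≤ ENNReal.ofReal |v.1⁻¹| • volume := by
  have h := map_proj_prod_lebesgueUnit_le μ (v := v.swap) hv
  rw [← Measure.prod_swap, Measure.map_map (measurable_proj v) measurable_swap]
  have : proj v ∘ Prod.swap = proj v.swap := by
    funext x; simp [proj, add_comm]
  rwa [this]

/-- A density bound on the projection is a convex condition, so it is enough to check it on the
generating products. -/
lemma entropyDim_eq_one_of_mem_convexHull {N : ℕ} {μ : Measure (ℝ × ℝ)}
    (hμ : IsInvariantOnSquare N μ) (h : μ ∈ convexHull ℝ≥0 (productsWithLebesgue N)) {v : ℝ × ℝ}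
    (hv1 : v.1 ≠ 0) (hv2 : v.2 ≠ 0) : entropyDim (μ.map (proj v)) = 1 := by
  have := hμ.isProbability
  have : IsProbabilityMeasure (μ.map (proj v)) :=
    Measure.isProbabilityMeasure_map (measurable_proj v).aemeasurable
  let C : ℝ≥0 := max (Real.toNNReal |v.1⁻¹|) (Real.toNNReal |v.2⁻¹|)
  have hC1 : ENNReal.ofReal |v.1⁻¹| ≤ C := ENNReal.coe_le_coe.2 (le_max_left _ _)
  have hC2 : ENNReal.ofReal |v.2⁻¹| ≤ C := ENNReal.coe_le_coe.2 (le_max_right _ _)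
  have hconv : Convex ℝ≥0 {ν : Measure (ℝ × ℝ) | ν.map (proj v) ≤ C • volume} := by
    intro ν₁ h₁ ν₂ h₂ a b _ _ hab
    change (a • ν₁ + b • ν₂).map (proj v) ≤ C • volume
    rw [Measure.map_add _ _ (measurable_proj v), Measure.map_smul, Measure.map_smul]
    refine Measure.le_iff.2 fun A _ ↦ ?_
    have e : C • (volume : Measure ℝ) = a • C • volume + b • C • volume := by
      rw [← add_smul, hab, one_smul]
    rw [e, Measure.add_apply, Measure.add_apply]
    exact add_le_add (mul_le_mul_right (h₁ A) _) (mul_le_mul_right (h₂ A) _)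
  have hsub : productsWithLebesgue N ⊆ {ν : Measure (ℝ × ℝ) | ν.map (proj v) ≤ C • volume} := by
    rintro ν (⟨μ₁, hμ₁, rfl⟩ | ⟨μ₂, hμ₂, rfl⟩)
    · have := hμ₁.isProbability
      exact (map_proj_prod_lebesgueUnit_le μ₁ hv2).trans fun A ↦ mul_le_mul_left hC2 _
    · have := hμ₂.isProbability
      exact (map_proj_lebesgueUnit_prod_le μ₂ hv1).trans fun A ↦ mul_le_mul_left hC1 _
  obtain ⟨M, -, hM⟩ := exists_map_proj_compl_Ico_eq_zero v
  exact entropyDim_eq_one_of_le_smul_volume (hM μ hμ.carried) (convexHull_min hsub hconv h)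

/-- Integrality of `p` and `q` is essential: $N P_v(x)$ and $P_v(T_N x)$ then differ by the integer
$p\lfloor Nx_1\rfloor+q\lfloor Nx_2\rfloor$. -/
lemma IsInvariantOnSquare.map_proj_fract {N : ℕ} {μ : Measure (ℝ × ℝ)}
    (hμ : IsInvariantOnSquare N μ) (p q : ℤ) :
    (μ.map (proj (p, q))).map (fun x : ℝ ↦ Int.fract (N * x)) =
      (μ.map (proj (p, q))).map Int.fract := by
  conv_rhs => rw [← hμ.invariant]
  rw [Measure.map_map (by fun_prop) (by fun_prop), Measure.map_map (by fun_prop) (by fun_prop),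
    Measure.map_map (by fun_prop) (by fun_prop)]
  congr 1
  funext x
  simp only [Function.comp_apply, proj, mulModOneTwo, mulModOne]
  rw [Int.fract_eq_fract]
  refine ⟨⌊(N : ℝ) * x.1⌋ * p + ⌊(N : ℝ) * x.2⌋ * q, ?_⟩
  rw [Int.fract, Int.fract]
  push_cast
  ring

lemma integral_planeChar_eq_zero_of_entropyDim_eq_one {N : ℕ} (hN : 1 < N)
    {μ : Measure (ℝ × ℝ)} (hμ : IsInvariantOnSquare N μ) {p q : ℤ}
    (hdim : entropyDim (μ.map (proj (p, q))) = 1) : ∫ x, planeChar p q x ∂μ = 0 := by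
  have := hμ.isProbability
  have : IsProbabilityMeasure (μ.map (proj (p, q))) :=
    Measure.isProbabilityMeasure_map (measurable_proj _).aemeasurable
  obtain ⟨M, hM0, hM⟩ := exists_map_proj_compl_Ico_eq_zero (p, q)
  have h := integral_exp_eq_zero_of_entropyDim_eq_one hN (hM μ hμ.carried) hM0
    (hμ.map_proj_fract p q) hdim
  rw [integral_map (measurable_proj _).aemeasurable (by fun_prop)] at h
  rw [← h]
  refine integral_congr_ae (Eventually.of_forall fun x ↦ ?_)
  simp only [planeChar, proj]
  push_cast
  ring_nf

end TimesN

theorem mainTheorem7 (N : ℕ) (hN : 2 ≤ N) (μ : MeasureTheory.Measure (ℝ × ℝ))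
    (hμ : TimesN.IsInvariantOnSquare N μ) :
    (∀ v : ℝ × ℝ, v.1 * v.2 ≠ 0 → TimesN.entropyDim (μ.map (TimesN.proj v)) = 1) ↔
      μ ∈ convexHull ℝ≥0 (TimesN.productsWithLebesgue N) := by
  refine ⟨fun h ↦ hμ.mem_convexHull hN fun p q hp hq ↦ ?_, fun h v hv ↦ ?_⟩
  · refine TimesN.integral_planeChar_eq_zero_of_entropyDim_eq_one hN hμ (h (p, q) ?_)
    exact mul_ne_zero (Int.cast_ne_zero.2 hp) (Int.cast_ne_zero.2 hq)
  · exact TimesN.entropyDim_eq_one_of_mem_convexHull hμ h (left_ne_zero_of_mul hv)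
      (right_ne_zero_of_mul hv)
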